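/- Let $n\ge 1$. Let $\mathrm{Av}^\star_{3n}(321)$ be the set of permutations $\pi=\pi_1\pi_2\cdots\pi_{3n}$ of $[3n]=\{1,\dots,3n\}$ whose cycle decomposition consists only of $3$-cycles and which avoid the pattern $321$, i.e. there are no indices $a<b<c$ with $\pi_a>\pi_b>\pi_c$. Let $\mathcal T_n$ be the set of all $n$-element subsets $T=\{t_1<t_2<\dots<t_n\}$ of $[3n]$ with $t_i\le 3i-2$ for every $1\le i\le n$. For a word $V$ on the alphabet $\{x,y,z\}$ let $X(V)$ and $Y(V)$ denote the numbers of $x$'s and $y$'s in $V$. For $T\in\mathcal T_n$ define the word $W(T)=w_1w_2\cdots w_{3n}$ letter by letter: having defined $V=w_1\cdots w_{k-1}$, - if $k\in T$, put $w_k=z$; - if $k\notin T$ and $X(V)=Y(V)$, put $w_k=x$; - if $k\notin T$ and $X(V)\neq Y(V)$ (in which case $X(V)>Y(V)$), let $j$ be the number of $z$'s that occur in $V$ before its $(Y(V)+1)$-st $x$; put $w_k=y$ if $j=X(V)$, and $w_k=x$ otherwise. For $1\le i\le Y(W(T))$ let $W^{(i)}$ be the initial segment of $W=W(T)$ that ends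 with the $i$-th occurrence of $y$, and let $h(T)$ be the number of indices $i$ with $X(W^{(i)})=i$. Then $$|\mathrm{Av}^\star_{3n}(321)|=\sum_{T\in\mathcal T_n}2^{h(T)}.$$ -/

import Mathlib

namespace ThreeCycles

/-- The permutation `π` (in one-line notation) contains the pattern `σ`: some subsequence of `π`
is in the same relative order as `σ`. -/
def ContainsPattern {k m : ℕ} (σ : Equiv.Perm (Fin k)) (π : Equiv.Perm (Fin m)) : Prop :=
  ∃ f : Fin k → Fin m, StrictMono f ∧ ∀ a b, π (f a) < π (f b) ↔ σ a < σ b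

/-- `π` avoids the pattern `σ`. -/
def Avoids {k m : ℕ} (π : Equiv.Perm (Fin m)) (σ : Equiv.Perm (Fin k)) : Prop :=
  ¬ ContainsPattern σ π

/-- The pattern `321`, i.e. the order-reversing permutation of three points. -/
def pattern321 : Equiv.Perm (Fin 3) := Fin.revPerm

/-- The permutations of `3n` points whose cycle decomposition consists of `n` three-cycles
(hence without fixed points) and which avoid the pattern `σ`. -/
def AvStar (n : ℕ) {k : ℕ} (σ : Equiv.Perm (Fin k)) : Set (Equiv.Perm (Fin (3 * n))) :=
  {π | π.cycleType = Multiset.replicate n 3 ∧ Avoids π σ}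

/-- The `n`-element subsets `t₁ < ⋯ < tₙ` of `{1, …, 3n}` with `tᵢ ≤ 3i - 2` for all `i`.
The index `i : Fin n` starts at `0`, so it stands for the mathematical index `i + 1`. -/
def TSets (n : ℕ) : Finset (Finset ℕ) :=
  ((Finset.Icc 1 (3 * n)).powersetCard n).filter fun T =>
    ∃ h : T.card = n, ∀ i : Fin n, T.orderEmbOfFin h i + 2 ≤ 3 * ((i : ℕ) + 1)

/-- The alphabet `{x, y, z}`. -/
inductive Letter
  | x
  | y
  | z
  deriving DecidableEq

/-- The number of `x`'s in a word. -/
def X (w : List Letter) : ℕ := w.count Letter.x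

/-- The number of `y`'s in a word. -/
def Y (w : List Letter) : ℕ := w.count Letter.y

/-- The initial part of a word up to and including the `i`-th occurrence of the letter `a`
(`i ≥ 1`); it is only used when there are at least `i` occurrences. -/
def throughNth (a : Letter) : ℕ → List Letter → List Letter
  | 0, _ => []
  | _ + 1, [] => []
  | i + 1, b :: w => b :: (if b = a then throughNth a i w else throughNth a (i + 1) w)

/-- The number of `z`'s before the `i`-th `x` of a word. -/
def zBeforeX (w : List Letter) (i : ℕ) : ℕ := (throughNth Letter.x i w).count Letter.z

/-- The letter in position `k` (positions start at `1`), given the word `w` formed by the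
letters in positions `1, …, k - 1`. -/
def nextLetter (T : Finset ℕ) (k : ℕ) (w : List Letter) : Letter :=
  if k ∈ T then Letter.z
  else if X w = Y w then Letter.x
  else if zBeforeX w (Y w + 1) = X w then Letter.y
  else Letter.x

/-- The first `k` letters of the word determined by `T`. -/
def wordPrefix (T : Finset ℕ) : ℕ → List Letter
  | 0 => []
  | k + 1 => wordPrefix T k ++ [nextLetter T (k + 1) (wordPrefix T k)]

/-- The word `W(T)` of length `3n`. -/
def W (n : ℕ) (T : Finset ℕ) : List Letter := wordPrefix T (3 * n)

/-- The `i`-th initial segment of a word: it ends with the `i`-th `y`. -/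
def initialSegment (w : List Letter) (i : ℕ) : List Letter := throughNth Letter.y i w

/-- The number of indices `i` (among those for which there is an `i`-th `y`) such that the `i`-th
initial segment of `W(T)` contains exactly `i` letters `x`. -/
def h (n : ℕ) (T : Finset ℕ) : ℕ :=
  ((Finset.Icc 1 (Y (W n T))).filter fun i => X (initialSegment (W n T) i) = i).card

end ThreeCycles

/-!
A permutation avoids `321` exactly when both it and its inverse are increasing on their weak
excedances. Write the cycles of a fixed-point-free `π` with `π ^ 3 = 1` as the columns of an array
whose rows `z`, `x`, `y` hold the minima, the medians and the maxima, and record for each column the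
direction in which `π` traverses it. Then `π` avoids `321` if and only if the rows are increasing,
the rows `z` and `x` are interlaced in the same way as the rows `x` and `y`, and columns traversed
in different directions have disjoint intervals from median to maximum.

The interlacing determines the array from its row of minima: scanning the positions from left to
right, each position outside `T` is forced to be a median or a maximum, which is the rule that
builds `W(T)`. The bound `tᵢ ≤ 3i - 2` is what keeps the scan from producing more than `n` medians.
Finally the columns fall into blocks of consecutive columns that must share their direction,
distinct blocks are independent, and the blocks end at the indices counted by `h(T)`.
-/

namespace ThreeCycles

open Equiv

theorem cycleType_eq_replicate_iff {α : Type*} [Fintype α] [DecidableEq α] {n p : ℕ}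
    [Fact p.Prime] (hα : Fintype.card α = p * n) (π : Perm α) :
    π.cycleType = Multiset.replicate n p ↔ π ^ p = 1 ∧ ∀ k, π k ≠ k := by
  have hp := (Fact.out : p.Prime).pos
  have sum_replicate (m : ℕ) : (Multiset.replicate m p).sum = p * m := by simp [mul_comm]
  constructor
  · intro h
    have hsupp : π.support = Finset.univ := by
      rw [← Finset.card_eq_iff_eq_univ, ← Perm.sum_cycleType, h, sum_replicate, hα]
    refine ⟨Perm.pow_prime_eq_one_iff.2 fun c hc => ?_, fun k => ?_⟩
    · exact Multiset.eq_of_mem_replicate (h ▸ hc)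
    · exact Perm.mem_support.1 (hsupp ▸ Finset.mem_univ k)
  · rintro ⟨hpow, hfix⟩
    have hrep := Multiset.eq_replicate_card.2 (Perm.pow_prime_eq_one_iff.1 hpow)
    have hsupp : π.support = Finset.univ :=
      Finset.eq_univ_of_forall fun k => Perm.mem_support.2 (hfix k)
    have hsum := Perm.sum_cycleType π
    rw [hrep, sum_replicate, hsupp, Finset.card_univ, hα] at hsum
    rw [hrep, Nat.eq_of_mul_eq_mul_left hp hsum]

theorem avoids_pattern321_iff {m : ℕ} (π : Perm (Fin m)) :
    Avoids π pattern321 ↔ ∀ i j k, i < j → j < k → π j < π i → ¬ π k < π j := by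
  refine not_iff_comm.1 ?_
  push Not
  constructor
  · rintro ⟨i, j, k, hij, hjk, hji, hkj⟩
    have hki := hkj.trans hji
    refine ⟨![i, j, k], Fin.strictMono_iff_lt_succ.2 ?_, ?_⟩
    · simp [Fin.forall_fin_succ, hij, hjk]
    · simp [Fin.forall_fin_succ, pattern321, hji, hkj, hki, hji.le, hkj.le, hki.le]
  · rintro ⟨f, hf, hπ⟩
    exact ⟨f 0, f 1, f 2, hf (by decide), hf (by decide), (hπ 1 0).2 (by decide),
      (hπ 2 1).2 (by decide)⟩

section Excedances

variable {α : Type*} [LinearOrder α] [Finite α]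

theorem exists_gt_apply_lt (π : Perm α) {p q : α} (hpq : p < q) (hq : q ≤ π q)
    (hqp : π q < π p) : ∃ k > q, π k < π q := by
  by_contra! hge
  have hmaps : Set.MapsTo π (insert p (Set.Ioi q)) (Set.Ioi (π q)) := by
    rintro k (rfl | hk)
    · exact hqp
    · exact (hge k hk).lt_of_ne (π.injective.ne (ne_of_gt hk).symm)
  have hcard := Set.ncard_le_ncard_of_injOn π hmaps π.injective.injOn
  rw [Set.ncard_insert_of_notMem (by simpa using hpq.le)] at hcard
  have hle : (Set.Ioi (π q)).ncard ≤ (Set.Ioi q).ncard :=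
    Set.ncard_le_ncard (Set.Ioi_subset_Ioi hq)
  omega

theorem strictMonoOn_weakExcedances {π : Perm α}
    (hπ : ∀ i j k, i < j → j < k → π j < π i → ¬ π k < π j) :
    StrictMonoOn π {p | p ≤ π p} := by
  intro p _ q hq hpq
  by_contra hle
  have hqp : π q < π p := (not_lt.1 hle).lt_of_ne (π.injective.ne hpq.ne')
  obtain ⟨k, hqk, hk⟩ := exists_gt_apply_lt π hpq hq hqp
  exact hπ p q k hpq hqk hqp hk

end Excedances

theorem avoids_pattern321_iff_strictMonoOn {m : ℕ} (π : Perm (Fin m)) :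
    Avoids π pattern321 ↔
      StrictMonoOn π {p | p ≤ π p} ∧ StrictMonoOn ⇑π⁻¹ {p | p ≤ π⁻¹ p} := by
  rw [avoids_pattern321_iff]
  constructor
  · refine fun hπ => ⟨strictMonoOn_weakExcedances hπ, strictMonoOn_weakExcedances ?_⟩
    intro i j k hij hjk hji hkj
    exact hπ (π⁻¹ k) (π⁻¹ j) (π⁻¹ i) hkj hji (by simpa using hjk) (by simpa using hij)
  · rintro ⟨hexc, hinv⟩ i j k hij hjk hji hkj
    rcases le_total j (π j) with hj | hj
    · exact (hexc (hij.le.trans (hj.trans hji.le)) hj hij).asymm hji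
    · have hk : π k ≤ π⁻¹ (π k) := by simpa using hkj.le.trans (hj.trans hjk.le)
      exact hjk.asymm (by simpa using hinv hk (by simpa using hj) hkj)

instance : Fintype Letter := ⟨{.x, .y, .z}, by rintro (_ | _ | _) <;> decide⟩

/-- The cyclic permutation `z → x → y → z` of the alphabet. -/
def Letter.rotate : Perm Letter where
  toFun
    | .z => .x
    | .x => .y
    | .y => .z
  invFun
    | .x => .z
    | .y => .x
    | .z => .y
  left_inv := by rintro (_ | _ | _) <;> rfl
  right_inv := by rintro (_ | _ | _) <;> rfl

section CyclePerm

variable {ι α : Type*}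

/-- The permutation of `α` whose cycles are the triples of `e`: the `i`-th one is
`e (i, z) → e (i, x) → e (i, y)` if `s i`, and the inverse of this cycle otherwise. -/
def cyclePerm (e : ι × Letter ≃ α) (s : ι → Bool) : Perm α :=
  e.permCongr (prodShear (Equiv.refl ι) fun i => bif s i then Letter.rotate else Letter.rotate⁻¹)

variable (e : ι × Letter ≃ α) (s : ι → Bool)

theorem cyclePerm_apply (i : ι) (l : Letter) :
    cyclePerm e s (e (i, l)) =
      e (i, (bif s i then Letter.rotate else Letter.rotate⁻¹) l) := by
  simp [cyclePerm, permCongr_apply, prodShear]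

theorem cyclePerm_apply_z (i : ι) :
    cyclePerm e s (e (i, .z)) = bif s i then e (i, .x) else e (i, .y) := by
  rw [cyclePerm_apply]
  cases s i <;> rfl

theorem cyclePerm_apply_x (i : ι) :
    cyclePerm e s (e (i, .x)) = bif s i then e (i, .y) else e (i, .z) := by
  rw [cyclePerm_apply]
  cases s i <;> rfl

theorem cyclePerm_apply_y (i : ι) :
    cyclePerm e s (e (i, .y)) = bif s i then e (i, .z) else e (i, .x) := by
  rw [cyclePerm_apply]
  cases s i <;> rfl

theorem cyclePerm_pow_three : cyclePerm e s ^ 3 = 1 := by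
  ext p
  obtain ⟨⟨i, l⟩, rfl⟩ := e.surjective p
  cases hs : s i <;> cases l <;> simp [pow_succ, cyclePerm_apply, hs] <;> rfl

theorem cyclePerm_apply_ne (p : α) : cyclePerm e s p ≠ p := by
  obtain ⟨⟨i, l⟩, rfl⟩ := e.surjective p
  cases hs : s i <;> cases l <;>
    simp only [cyclePerm_apply, hs, ne_eq, e.injective.eq_iff, Prod.mk.injEq, true_and] <;> decide

theorem cyclePerm_inv : (cyclePerm e s)⁻¹ = cyclePerm e (!s ·) := by
  rw [inv_eq_iff_mul_eq_one]
  ext p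
  obtain ⟨⟨i, l⟩, rfl⟩ := e.surjective p
  cases hs : s i <;> simp [cyclePerm_apply, hs]

theorem cyclePerm_injective : Function.Injective (cyclePerm e) := by
  intro s t h
  ext i
  have hi := congrArg (fun π : Perm α => π (e (i, .z))) h
  simp only [cyclePerm_apply, e.injective.eq_iff, Prod.mk.injEq, true_and] at hi
  revert hi
  cases s i <;> cases t i <;> decide

end CyclePerm

/-- The triples of `e` list the minimum, the median and the maximum in the rows `z`, `x` and `y`,
and they are themselves sorted by their minima. -/
structure IsSorted {ι α : Type*} [LinearOrder ι] [LinearOrder α] (e : ι × Letter ≃ α) : Prop where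
  strictMono_z : StrictMono fun i => e (i, .z)
  z_lt_x : ∀ i, e (i, .z) < e (i, .x)
  x_lt_y : ∀ i, e (i, .x) < e (i, .y)

/-- The set of the least points of the cycles of a permutation, for permutations all of whose cycles
have length three. -/
def cycleMinima {α : Type*} [LinearOrder α] [Fintype α] (π : Perm α) : Finset α :=
  {p | p < π p ∧ p < π (π p)}

theorem mem_cycleMinima {α : Type*} [LinearOrder α] [Fintype α] {π : Perm α} {p : α} :
    p ∈ cycleMinima π ↔ p < π p ∧ p < π (π p) :=
  Finset.mem_filter_univ _

/-- The triple of `p`, `π p` and `π (π p)`, with `p` in the row `z` and the other two in increasing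
order in the rows `x` and `y`; this sorts the cycle of `p` if `p` is a cycle minimum. -/
def cycleEntry {α : Type*} [LinearOrder α] (π : Perm α) (p : α) : Letter → α
  | .z => p
  | .x => min (π p) (π (π p))
  | .y => max (π p) (π (π p))

theorem cycleEntry_x_lt_y {α : Type*} [LinearOrder α] {π : Perm α} (hfix : ∀ k, π k ≠ k) (p : α) :
    cycleEntry π p .x < cycleEntry π p .y :=
  min_lt_max.2 (hfix (π p)).symm

theorem apply_apply_apply_of_pow_three_eq_one {α : Type*} {π : Perm α} (hpow : π ^ 3 = 1) (k : α) :
    π (π (π k)) = k := by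
  simpa [pow_succ] using congrArg (fun σ : Perm α => σ k) hpow

section CycleMinima

variable {ι α : Type*} [LinearOrder ι] [LinearOrder α] [Fintype α]

theorem IsSorted.cycleMinima_cyclePerm [Fintype ι] {e : ι × Letter ≃ α} (he : IsSorted e)
    (s : ι → Bool) :
    cycleMinima (cyclePerm e s) = Finset.univ.image fun i => e (i, .z) := by
  ext p
  obtain ⟨⟨i, l⟩, rfl⟩ := e.surjective p
  have hzx := he.z_lt_x i
  have hxy := he.x_lt_y i
  have hzy := hzx.trans hxy
  cases hs : s i <;> cases l <;>
    simp [mem_cycleMinima, cyclePerm_apply_x, cyclePerm_apply_y, cyclePerm_apply_z, *, le_of_lt]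

variable {π : Perm α}

theorem exists_cycleMinima_cases (hpow : π ^ 3 = 1) (hfix : ∀ k, π k ≠ k) (k : α) :
    ∃ p ∈ cycleMinima π, k = p ∨ k = π p ∨ k = π (π p) := by
  have hcube := apply_apply_apply_of_pow_three_eq_one hpow
  have hne := hfix (π k)
  have hne' : π (π k) ≠ k := fun h => hfix k (by simpa [h] using hcube k)
  simp only [mem_cycleMinima]
  by_cases h₁ : k < π k ∧ k < π (π k)
  · exact ⟨k, h₁, .inl rfl⟩
  by_cases h₂ : π k < π (π k) ∧ π k < k
  · exact ⟨π k, by rwa [hcube], .inr (.inr (hcube k).symm)⟩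
  · have h₃ : π (π k) < k ∧ π (π k) < π k := by grind
    exact ⟨π (π k), by rwa [hcube], .inr (.inl (hcube k).symm)⟩

theorem cycleEntry_z_lt_x {p : α} (hp : p ∈ cycleMinima π) :
    cycleEntry π p .z < cycleEntry π p .x :=
  lt_min (mem_cycleMinima.1 hp).1 (mem_cycleMinima.1 hp).2

theorem min_orbit_cycleEntry (hpow : π ^ 3 = 1) {p : α} (hp : p ∈ cycleMinima π) (l : Letter) :
    min (cycleEntry π p l) (min (π (cycleEntry π p l)) (π (π (cycleEntry π p l)))) = p := by
  have hcube := apply_apply_apply_of_pow_three_eq_one hpow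
  obtain ⟨h₁, h₂⟩ := mem_cycleMinima.1 hp
  rcases le_total (π p) (π (π p)) with h | h <;> cases l <;>
    simp [cycleEntry, h, h₁.le, h₂.le, hcube]

theorem bijective_cycleEntry (hpow : π ^ 3 = 1) (hfix : ∀ k, π k ≠ k) :
    Function.Bijective fun c : cycleMinima π × Letter => cycleEntry π c.1 c.2 := by
  constructor
  · rintro ⟨p, l⟩ ⟨q, l'⟩ h
    obtain rfl : p = q := Subtype.ext (by
      rw [← min_orbit_cycleEntry hpow p.2 l, ← min_orbit_cycleEntry hpow q.2 l',
        show cycleEntry π p l = cycleEntry π q l' from h])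
    have := cycleEntry_z_lt_x p.2
    have := cycleEntry_x_lt_y hfix p
    cases l <;> cases l' <;> first | rfl | (dsimp only at h; order)
  · intro k
    obtain ⟨p, hp, hk⟩ := exists_cycleMinima_cases hpow hfix k
    rcases hk with hk | hk | hk
    · exact ⟨(⟨p, hp⟩, .z), hk.symm⟩
    · rcases le_total (π p) (π (π p)) with h | h
      · exact ⟨(⟨p, hp⟩, .x), by simp [cycleEntry, h, hk]⟩
      · exact ⟨(⟨p, hp⟩, .y), by simp [cycleEntry, h, hk]⟩
    · rcases le_total (π p) (π (π p)) with h | h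
      · exact ⟨(⟨p, hp⟩, .y), by simp [cycleEntry, h, hk]⟩
      · exact ⟨(⟨p, hp⟩, .x), by simp [cycleEntry, h, hk]⟩

theorem exists_isSorted_cyclePerm_eq (hpow : π ^ 3 = 1) (hfix : ∀ k, π k ≠ k) :
    ∃ (e : cycleMinima π × Letter ≃ α) (s : cycleMinima π → Bool),
      IsSorted e ∧ cyclePerm e s = π := by
  have hcube := apply_apply_apply_of_pow_three_eq_one hpow
  let e := Equiv.ofBijective _ (bijective_cycleEntry hpow hfix)
  refine ⟨e, fun p => decide (π p < π (π p)),
    ⟨fun p q h => h, fun p => cycleEntry_z_lt_x p.2, fun p => cycleEntry_x_lt_y hfix p⟩, ?_⟩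
  ext k
  obtain ⟨⟨p, l⟩, rfl⟩ := e.surjective k
  rw [cyclePerm_apply]
  by_cases h : π p < π (π p) <;> cases l <;>
    simp [e, cycleEntry, h, hcube, Letter.rotate, Perm.inv_def, le_of_lt, not_lt.1]

theorem exists_fin_isSorted_cyclePerm_eq {n : ℕ} (hα : Fintype.card α = 3 * n)
    (hpow : π ^ 3 = 1) (hfix : ∀ k, π k ≠ k) :
    ∃ (e : Fin n × Letter ≃ α) (s : Fin n → Bool), IsSorted e ∧ cyclePerm e s = π := by
  obtain ⟨e, s, he, hπ⟩ := exists_isSorted_cyclePerm_eq hpow hfix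
  have hcard : (cycleMinima π).card = n := by
    have h := Fintype.card_congr e
    rw [Fintype.card_prod, Fintype.card_coe, hα, show Fintype.card Letter = 3 from rfl] at h
    omega
  let f := (cycleMinima π).orderIsoOfFin hcard
  refine ⟨(f.toEquiv.prodCongr (Equiv.refl _)).trans e, s ∘ f,
    ⟨fun i j hij => he.strictMono_z (f.strictMono hij), fun i => he.z_lt_x (f i),
      fun i => he.x_lt_y (f i)⟩, (Equiv.ext fun k => ?_).trans hπ⟩
  obtain ⟨⟨p, l⟩, rfl⟩ := e.surjective k
  obtain ⟨i, rfl⟩ := f.surjective p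
  exact (cyclePerm_apply ((f.toEquiv.prodCongr (Equiv.refl _)).trans e) (s ∘ f) i l).trans
    (cyclePerm_apply e s (f i) l).symm

end CycleMinima

section Interlaced

variable {ι α : Type*} [LinearOrder ι] [LinearOrder α] {e : ι × Letter ≃ α} {s : ι → Bool}

/-- The rows of `e` are increasing, the columns are increasing in the order `z`, `x`, `y`, and the
rows `z` and `x` compare with each other in the same way as the rows `x` and `y`. -/
structure IsInterlaced (e : ι × Letter ≃ α) : Prop where
  strictMono : ∀ l, StrictMono fun i => e (i, l)
  x_lt_y : ∀ i, e (i, .x) < e (i, .y)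
  z_lt_x_iff : ∀ i j, e (i, .z) < e (j, .x) ↔ e (i, .x) < e (j, .y)

theorem IsInterlaced.isSorted (he : IsInterlaced e) : IsSorted e :=
  ⟨he.strictMono .z, fun i => (he.z_lt_x_iff i i).2 (he.x_lt_y i), he.x_lt_y⟩

/-- A choice of orientations under which triples that are oriented differently have disjoint
intervals from their median to their maximum. -/
def IsOrientation (e : ι × Letter ≃ α) (s : ι → Bool) : Prop :=
  ∀ i j, i < j → s i ≠ s j → e (i, .y) < e (j, .x)

theorem isOrientation_not : IsOrientation e (!s ·) ↔ IsOrientation e s := by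
  simp [IsOrientation]

theorem IsSorted.lt_iff_of_orientation_eq (he : IsSorted e)
    (hmono : StrictMonoOn (cyclePerm e s) {p | p ≤ cyclePerm e s p}) {i j : ι}
    (hi : s i = true) (hj : s j = true) :
    (i < j ↔ e (i, .x) < e (j, .x)) ∧ (e (i, .z) < e (j, .x) ↔ e (i, .x) < e (j, .y)) ∧
      (e (i, .x) < e (j, .x) ↔ e (i, .y) < e (j, .y)) := by
  have apply_z {k : ι} (hk : s k = true) : cyclePerm e s (e (k, .z)) = e (k, .x) := by
    simp [cyclePerm_apply_z, hk]
  have apply_x {k : ι} (hk : s k = true) : cyclePerm e s (e (k, .x)) = e (k, .y) := by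
    simp [cyclePerm_apply_x, hk]
  have mem_z {k : ι} (hk : s k = true) : e (k, .z) ∈ {p | p ≤ cyclePerm e s p} :=
    (he.z_lt_x k).le.trans_eq (apply_z hk).symm
  have mem_x {k : ι} (hk : s k = true) : e (k, .x) ∈ {p | p ≤ cyclePerm e s p} :=
    (he.x_lt_y k).le.trans_eq (apply_x hk).symm
  refine ⟨?_, ?_, ?_⟩
  · rw [← apply_z hi, ← apply_z hj, hmono.lt_iff_lt (mem_z hi) (mem_z hj)]
    exact he.strictMono_z.lt_iff_lt.symm
  · rw [← hmono.lt_iff_lt (mem_z hi) (mem_x hj), apply_z hi, apply_x hj]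
  · rw [← hmono.lt_iff_lt (mem_x hi) (mem_x hj), apply_x hi, apply_x hj]

theorem IsSorted.lt_iff_of_orientation_ne (he : IsSorted e)
    (hmono : StrictMonoOn (cyclePerm e s) {p | p ≤ cyclePerm e s p}) {i j : ι}
    (hi : s i = true) (hj : s j = false) :
    (i < j ↔ e (i, .x) < e (j, .y)) ∧ (e (i, .x) < e (j, .z) ↔ e (i, .y) < e (j, .y)) := by
  have apply_zi : cyclePerm e s (e (i, .z)) = e (i, .x) := by
    simp [cyclePerm_apply_z, hi]
  have apply_xi : cyclePerm e s (e (i, .x)) = e (i, .y) := by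
    simp [cyclePerm_apply_x, hi]
  have apply_zj : cyclePerm e s (e (j, .z)) = e (j, .y) := by
    simp [cyclePerm_apply_z, hj]
  have mem_zi : e (i, .z) ∈ {p | p ≤ cyclePerm e s p} := (he.z_lt_x i).le.trans_eq apply_zi.symm
  have mem_xi : e (i, .x) ∈ {p | p ≤ cyclePerm e s p} := (he.x_lt_y i).le.trans_eq apply_xi.symm
  have mem_zj : e (j, .z) ∈ {p | p ≤ cyclePerm e s p} :=
    ((he.z_lt_x j).trans (he.x_lt_y j)).le.trans_eq apply_zj.symm
  constructor
  · rw [← apply_zi, ← apply_zj, hmono.lt_iff_lt mem_zi mem_zj]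
    exact he.strictMono_z.lt_iff_lt.symm
  · rw [← hmono.lt_iff_lt mem_xi mem_zj, apply_xi, apply_zj]

theorem IsSorted.y_lt_x_and_x_lt_z_of_orientation_ne (he : IsSorted e)
    (hmono : StrictMonoOn (cyclePerm e s) {p | p ≤ cyclePerm e s p})
    (hmono' : StrictMonoOn (cyclePerm e (!s ·)) {p | p ≤ cyclePerm e (!s ·) p})
    {i j : ι} (hij : i < j) (hs : s i ≠ s j) :
    e (i, .y) < e (j, .x) ∧ e (i, .x) < e (j, .z) := by
  have hyx : e (i, .y) ≠ e (j, .x) := by simp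
  have hy := he.x_lt_y j
  cases hi : s i <;> cases hj : s j
  any_goals simp [hi, hj] at hs
  · have h₁ := he.lt_iff_of_orientation_ne hmono hj hi
    have h₂ := he.lt_iff_of_orientation_ne hmono' (i := i) (j := j) (by simp [hi]) (by simp [hj])
    grind
  · have h₁ := he.lt_iff_of_orientation_ne hmono hi hj
    have h₂ := he.lt_iff_of_orientation_ne hmono' (i := j) (j := i) (by simp [hj]) (by simp [hi])
    grind

theorem IsSorted.isInterlaced_and_isOrientation (he : IsSorted e)
    (hmono : StrictMonoOn (cyclePerm e s) {p | p ≤ cyclePerm e s p})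
    (hmono' : StrictMonoOn (cyclePerm e (!s ·)) {p | p ≤ cyclePerm e (!s ·) p}) :
    IsInterlaced e ∧ IsOrientation e s := by
  have of_eq {i j : ι} (hs : s i = s j) :
      (i < j ↔ e (i, .x) < e (j, .x)) ∧ (e (i, .z) < e (j, .x) ↔ e (i, .x) < e (j, .y)) ∧
        (e (i, .x) < e (j, .x) ↔ e (i, .y) < e (j, .y)) := by
    cases hi : s i
    · exact he.lt_iff_of_orientation_eq hmono' (by simp [hi]) (by simp [← hs, hi])
    · exact he.lt_iff_of_orientation_eq hmono hi (hs ▸ hi)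
  have of_ne {i j : ι} (hij : i < j) (hs : s i ≠ s j) :=
    he.y_lt_x_and_x_lt_z_of_orientation_ne hmono hmono' hij hs
  refine ⟨⟨fun l i j hij => ?_, he.x_lt_y, fun i j => ?_⟩, fun i j hij hs => (of_ne hij hs).1⟩
  · have hy := he.x_lt_y j
    have hz : e (i, .z) < e (j, .z) := he.strictMono_z hij
    by_cases hs : s i = s j <;> cases l <;> grind
  · by_cases hs : s i = s j
    · exact (of_eq hs).2.1
    · have hz := he.z_lt_x i
      have hx := he.x_lt_y i
      have hy := he.x_lt_y j
      rcases lt_trichotomy i j with hij | rfl | hji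
      · have := of_ne hij hs
        exact iff_of_true (by order) (by order)
      · exact absurd rfl hs
      · have := of_ne hji (Ne.symm hs)
        exact iff_of_false (by order) (by order)

theorem IsInterlaced.strictMonoOn_cyclePerm (he : IsInterlaced e) (hs : IsOrientation e s) :
    StrictMonoOn (cyclePerm e s) {p | p ≤ cyclePerm e s p} := by
  rintro p hp q hq hpq
  obtain ⟨⟨i, l⟩, rfl⟩ := e.surjective p
  obtain ⟨⟨j, l'⟩, rfl⟩ := e.surjective q
  have row (l : Letter) : e (i, l) < e (j, l) ↔ i < j := (he.strictMono l).lt_iff_lt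
  have hyx : e (i, .y) ≠ e (j, .x) := by simp
  have hzx := he.isSorted.z_lt_x
  have hxy := he.x_lt_y
  have hji := he.z_lt_x_iff j i
  have hij := he.z_lt_x_iff i j
  have hlt := hs i j
  have hgt := hs j i
  have hrow := row .z
  have hrow' := row .x
  have hrow'' := row .y
  rw [Set.mem_ofPred_eq] at hp hq
  cases l <;> cases l' <;>
    simp only [cyclePerm_apply_x, cyclePerm_apply_y, cyclePerm_apply_z] at hp hq ⊢ <;>
    cases hi : s i <;> cases hj : s j <;> grind

theorem avoids_cyclePerm_iff {m : ℕ} {e : ι × Letter ≃ Fin m} (he : IsSorted e) :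
    Avoids (cyclePerm e s) pattern321 ↔ IsInterlaced e ∧ IsOrientation e s := by
  rw [avoids_pattern321_iff_strictMonoOn, cyclePerm_inv]
  refine ⟨fun h => he.isInterlaced_and_isOrientation h.1 h.2, fun h => ?_⟩
  refine ⟨h.1.strictMonoOn_cyclePerm h.2, ?_⟩
  exact h.1.strictMonoOn_cyclePerm (isOrientation_not.2 h.2)

end Interlaced

theorem mem_avStar_pattern321_iff {n : ℕ} {π : Perm (Fin (3 * n))} :
    π ∈ AvStar n pattern321 ↔
      ∃ (e : Fin n × Letter ≃ Fin (3 * n)) (s : Fin n → Bool),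
        IsInterlaced e ∧ IsOrientation e s ∧ cyclePerm e s = π := by
  rw [AvStar, Set.mem_ofPred_eq, cycleType_eq_replicate_iff (Fintype.card_fin _)]
  constructor
  · rintro ⟨⟨hpow, hfix⟩, hav⟩
    obtain ⟨e, s, he, rfl⟩ := exists_fin_isSorted_cyclePerm_eq (Fintype.card_fin _) hpow hfix
    obtain ⟨hint, hs⟩ := (avoids_cyclePerm_iff he).1 hav
    exact ⟨e, s, hint, hs, rfl⟩
  · rintro ⟨e, s, he, hs, rfl⟩
    exact ⟨⟨cyclePerm_pow_three e s, cyclePerm_apply_ne e s⟩,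
      (avoids_cyclePerm_iff he.isSorted).2 ⟨he, hs⟩⟩

section Uniqueness

variable {ι α : Type*} [LinearOrder ι] [LinearOrder α] {e e' : ι × Letter ≃ α}

theorem IsInterlaced.x_ne_y (he : IsInterlaced e) (he' : IsInterlaced e')
    (hz : ∀ i, e (i, .z) = e' (i, .z)) {k : α}
    (hk : ∀ p < k, e.symm p = e'.symm p) {i j : ι} (hi : e (i, .x) = k) : e' (j, .y) ≠ k := by
  intro hj
  have eq_of_lt {c : ι × Letter} (hc : e c < k) : e' c = e c := by
    rw [← Equiv.eq_symm_apply, ← hk _ hc, Equiv.symm_apply_apply]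
  have eq_of_lt' {c : ι × Letter} (hc : e' c < k) : e c = e' c := by
    rw [← Equiv.eq_symm_apply, hk _ hc, Equiv.symm_apply_apply]
  have hxj : e (j, .x) = e' (j, .x) := eq_of_lt' (hj ▸ he'.x_lt_y j)
  have hxi : k ≤ e' (i, .x) := by
    by_contra! h
    exact h.ne ((eq_of_lt' h).symm.trans hi)
  have hz_le : ¬ e (i, .z) < e (j, .x) := by
    rw [hz, hxj, he'.z_lt_x_iff, hj]
    exact not_lt.2 hxi
  have hyj : e (j, .y) ≠ e (i, .x) := by simp
  have hyj_lt : e (j, .y) < k :=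
    hi ▸ (not_lt.1 (mt (he.z_lt_x_iff i j).2 hz_le)).lt_of_ne hyj
  exact hyj_lt.ne ((eq_of_lt hyj_lt).symm.trans hj)

theorem IsInterlaced.index_le (he : IsInterlaced e) {k : α}
    (hk : ∀ p < k, e.symm p = e'.symm p) {i j : ι} {l : Letter} (hi : e (i, l) = k)
    (hj : e' (j, l) = k) : i ≤ j := by
  by_contra! hji
  have hlt : e (j, l) < k := hi ▸ he.strictMono l hji
  have h := hk _ hlt
  rw [Equiv.symm_apply_apply, Equiv.eq_symm_apply, hj] at h
  exact hlt.ne h.symm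

theorem IsInterlaced.eq_of_row_z_eq [WellFoundedLT α] (he : IsInterlaced e)
    (he' : IsInterlaced e') (hz : ∀ i, e (i, .z) = e' (i, .z)) : e = e' := by
  refine Equiv.symm_bijective.injective (Equiv.ext fun k => ?_)
  induction k using WellFoundedLT.induction with
  | _ k hk =>
  have hk' : ∀ p < k, e'.symm p = e.symm p := fun p hp => (hk p hp).symm
  obtain ⟨⟨i, l⟩, hi⟩ := e.surjective k
  obtain ⟨⟨j, l'⟩, hj⟩ := e'.surjective k
  have of_z {m : ι} (hm : e (m, .z) = k) : e.symm k = e'.symm k :=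
    (e.symm_apply_eq.2 hm.symm).trans (e'.symm_apply_eq.2 ((hz m).symm.trans hm).symm).symm
  have of_row_eq {m : Letter} (hi : e (i, m) = k) (hj : e' (j, m) = k) :
      e.symm k = e'.symm k := by
    obtain rfl := (he.index_le hk hi hj).antisymm (he'.index_le hk' hj hi)
    exact (e.symm_apply_eq.2 hi.symm).trans (e'.symm_apply_eq.2 hj.symm).symm
  match l, l', hi, hj with
  | .z, _, hi, _ => exact of_z hi
  | _, .z, _, hj => exact of_z ((hz j).trans hj)
  | .x, .x, hi, hj | .y, .y, hi, hj => exact of_row_eq hi hj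
  | .x, .y, hi, hj => exact absurd hj (he.x_ne_y he' hz hk hi)
  | .y, .x, hi, hj => exact absurd hi (he'.x_ne_y he (fun m => (hz m).symm) hk' hj)

end Uniqueness

section Orientations

variable {ι : Type*}

theorem ncard_setOf_eq_comp_retraction (B : Finset ι) {r : ι → ι}
    (hr : ∀ i, r i ∈ B) (hrB : ∀ i ∈ B, r i = i) :
    {s : ι → Bool | ∀ i, s i = s (r i)}.ncard = 2 ^ B.card := by
  let extend : (B → Bool) → ι → Bool := fun t i => t ⟨r i, hr i⟩
  have extend_injective : Function.Injective extend := fun t t' h => funext fun b => by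
    simpa [extend, hrB b b.2] using congrFun h b
  have range_extend : {s : ι → Bool | ∀ i, s i = s (r i)} = Set.range extend := by
    ext s
    constructor
    · exact fun hs => ⟨fun b => s b, funext fun i => (hs i).symm⟩
    · rintro ⟨t, rfl⟩ i
      simp [extend, hrB _ (hr i)]
  rw [range_extend, ← Set.image_univ, Set.ncard_image_of_injective _ extend_injective,
    Set.ncard_univ, Nat.card_fun, Nat.card_eq_fintype_card, Nat.card_eq_fintype_card,
    Fintype.card_bool, Fintype.card_coe]

variable {α : Type*} [LinearOrder ι] [Fintype ι] [LinearOrder α]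

/-- The indices after which no later interval from the median to the maximum of a triple meets the
previous ones; they end the blocks of triples that must be oriented in the same way. -/
def blockEnds (e : ι × Letter ≃ α) : Finset ι := {i | ∀ j, i < j → e (i, .y) < e (j, .x)}

theorem mem_blockEnds {e : ι × Letter ≃ α} {i : ι} :
    i ∈ blockEnds e ↔ ∀ j, i < j → e (i, .y) < e (j, .x) :=
  Finset.mem_filter_univ _

theorem exists_isLeast_blockEnds (e : ι × Letter ≃ α) (i : ι) :
    ∃ k, IsLeast {k | k ∈ blockEnds e ∧ i ≤ k} k := by
  have : Nonempty ι := ⟨i⟩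
  let last := Finset.univ.max' (Finset.univ_nonempty (α := ι))
  have last_mem : last ∈ blockEnds e := mem_blockEnds.2 fun j hj =>
    absurd hj (Finset.le_max' _ j (Finset.mem_univ j)).not_gt
  have hne : {k ∈ blockEnds e | i ≤ k}.Nonempty :=
    ⟨last, Finset.mem_filter.2 ⟨last_mem, Finset.le_max' _ i (Finset.mem_univ i)⟩⟩
  exact ⟨_, by simpa using Finset.isLeast_min' _ hne⟩

theorem isOrientation_iff {e : ι × Letter ≃ α} (he : IsInterlaced e) {s : ι → Bool} {r : ι → ι}
    (hr : ∀ i, IsLeast {k | k ∈ blockEnds e ∧ i ≤ k} (r i)) :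
    IsOrientation e s ↔ ∀ i, s i = s (r i) := by
  have lt_of_gt {i j : ι} (hij : r i < j) : e (r i, .y) < e (j, .x) :=
    mem_blockEnds.1 (hr i).1.1 j hij
  constructor
  · intro hs i
    by_contra hi
    obtain ⟨k, ⟨hik, hkr, hk⟩, hmax⟩ := (Set.toFinite {k | i ≤ k ∧ k ≤ r i ∧ s k ≠ s (r i)})
      |>.exists_maximal ⟨i, le_rfl, (hr i).1.2, hi⟩
    have hk_lt : k < r i := hkr.lt_of_ne fun h => hk (h ▸ rfl)
    have hk_mem : k ∈ blockEnds e := by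
      refine mem_blockEnds.2 fun j hkj => ?_
      rcases lt_or_ge (r i) j with hj | hj
      · exact (he.strictMono .y hk_lt).trans (lt_of_gt hj)
      · exact hs k j hkj fun hkj' => hkj.not_ge (hmax ⟨hik.trans hkj.le, hj, hkj' ▸ hk⟩ hkj.le)
    exact hk_lt.not_ge ((hr i).2 ⟨hk_mem, hik⟩)
  · intro hs i j hij hne
    rcases lt_or_ge (r i) j with hj | hj
    · exact ((he.strictMono .y).monotone (hr i).1.2).trans_lt (lt_of_gt hj)
    · have hr_eq : r i = r j :=
        ((hr i).2 ⟨(hr j).1.1, hij.le.trans (hr j).1.2⟩).antisymm ((hr j).2 ⟨(hr i).1.1, hj⟩)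
      exact absurd (by rw [hs i, hs j, hr_eq]) hne

theorem ncard_isOrientation {e : ι × Letter ≃ α} (he : IsInterlaced e) :
    {s | IsOrientation e s}.ncard = 2 ^ (blockEnds e).card := by
  choose r hr using exists_isLeast_blockEnds e
  simp_rw [isOrientation_iff he hr]
  refine ncard_setOf_eq_comp_retraction _ (fun i => (hr i).1.1) fun i hi => ?_
  exact ((hr i).2 ⟨hi, le_rfl⟩).antisymm (hr i).1.2

end Orientations

section Minima

variable {n m : ℕ}

/-- The cycle minima of a permutation, as positions counted from `1`. -/
def minimaSet (π : Perm (Fin m)) : Finset ℕ := (cycleMinima π).image fun p : Fin m => (p : ℕ) + 1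

/-- The entries of the row `z` of an array, as positions counted from `1`. -/
def rowZ (e : Fin n × Letter ≃ Fin m) : Finset ℕ :=
  Finset.univ.image fun i => (e (i, .z) : ℕ) + 1

variable {e e' : Fin n × Letter ≃ Fin m}

theorem IsSorted.minimaSet_cyclePerm (he : IsSorted e) (s : Fin n → Bool) :
    minimaSet (cyclePerm e s) = rowZ e := by
  rw [minimaSet, he.cycleMinima_cyclePerm, Finset.image_image]
  rfl

theorem card_rowZ (e : Fin n × Letter ≃ Fin m) : (rowZ e).card = n := by
  rw [rowZ, Finset.card_image_of_injective, Finset.card_univ, Fintype.card_fin]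
  intro i j h
  simpa [Fin.val_inj] using h

theorem IsSorted.orderEmbOfFin_rowZ (he : IsSorted e) (h : (rowZ e).card = n) (i : Fin n) :
    (rowZ e).orderEmbOfFin h i = e (i, .z) + 1 := by
  refine (congrFun (Finset.orderEmbOfFin_unique h (f := fun i => (e (i, .z) : ℕ) + 1) ?_ ?_) i).symm
  · exact fun i => Finset.mem_image_of_mem _ (Finset.mem_univ i)
  · exact fun i j hij => Nat.succ_lt_succ (he.strictMono_z hij)

theorem IsSorted.rowZ_eq_rowZ_iff (he : IsSorted e) (he' : IsSorted e') :
    rowZ e = rowZ e' ↔ ∀ i, e (i, .z) = e' (i, .z) := by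
  constructor
  · intro h i
    have hi := he.orderEmbOfFin_rowZ (card_rowZ e) i
    simp only [h, he'.orderEmbOfFin_rowZ] at hi
    exact Fin.ext (Nat.succ_injective hi.symm)
  · intro h
    simp only [rowZ, h]

theorem IsSorted.row_z_le (he : IsSorted e) (i : Fin n) : (e (i, .z) : ℕ) ≤ 3 * i := by
  have hmaps : Set.MapsTo e.symm (Finset.Iio (e (i, .z)))
      (Finset.Iio i ×ˢ (Finset.univ : Finset Letter) : Finset (Fin n × Letter)) := by
    intro p hp
    obtain ⟨⟨j, l⟩, rfl⟩ := e.surjective p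
    have hj : e (j, .z) < e (i, .z) := by
      have hl : e (j, l) < e (i, .z) := by simpa using hp
      have hzx := he.z_lt_x j
      have hxy := he.x_lt_y j
      cases l <;> order
    simpa using he.strictMono_z.lt_iff_lt.1 hj
  have hcard := Finset.card_le_card_of_injOn _ hmaps e.symm.injective.injOn
  rw [Finset.card_product, Fin.card_Iio, Fin.card_Iio, Finset.card_univ,
    show Fintype.card Letter = 3 from rfl] at hcard
  omega

theorem IsSorted.rowZ_mem_TSets {e : Fin n × Letter ≃ Fin (3 * n)} (he : IsSorted e) :
    rowZ e ∈ TSets n := by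
  refine Finset.mem_filter.2 ⟨Finset.mem_powersetCard.2 ⟨fun t ht => ?_, card_rowZ e⟩,
    card_rowZ e, fun i => ?_⟩
  · obtain ⟨i, -, rfl⟩ := Finset.mem_image.1 ht
    exact Finset.mem_Icc.2 ⟨Nat.succ_pos _, (e (i, .z)).isLt⟩
  · rw [he.orderEmbOfFin_rowZ]
    have := he.row_z_le i
    omega

theorem minimaSet_mem_TSets {π : Perm (Fin (3 * n))} (hπ : π ∈ AvStar n pattern321) :
    minimaSet π ∈ TSets n := by
  obtain ⟨e, s, he, -, rfl⟩ := mem_avStar_pattern321_iff.1 hπ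
  rw [he.isSorted.minimaSet_cyclePerm]
  exact he.isSorted.rowZ_mem_TSets

theorem IsInterlaced.ncard_avStar_minimaSet_eq {e : Fin n × Letter ≃ Fin (3 * n)}
    (he : IsInterlaced e) :
    {π ∈ AvStar n pattern321 | minimaSet π = rowZ e}.ncard = 2 ^ (blockEnds e).card := by
  have fiber_eq : {π ∈ AvStar n pattern321 | minimaSet π = rowZ e} =
      cyclePerm e '' {s | IsOrientation e s} := by
    ext π
    constructor
    · rintro ⟨hπ, hmin⟩
      obtain ⟨e', s, he', hs, rfl⟩ := mem_avStar_pattern321_iff.1 hπ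
      rw [he'.isSorted.minimaSet_cyclePerm, he'.isSorted.rowZ_eq_rowZ_iff he.isSorted] at hmin
      obtain rfl := he'.eq_of_row_z_eq he hmin
      exact ⟨s, hs, rfl⟩
    · rintro ⟨s, hs, rfl⟩
      exact ⟨mem_avStar_pattern321_iff.2 ⟨e, s, he, hs, rfl⟩, he.isSorted.minimaSet_cyclePerm s⟩
  rw [fiber_eq, Set.ncard_image_of_injective _ (cyclePerm_injective e), ncard_isOrientation he]

end Minima

theorem exists_count_eq_of_lt_count {p : ℕ → Prop} [DecidablePred p] {i k : ℕ}
    (h : i < Nat.count p k) : ∃ m < k, p m ∧ Nat.count p m = i := by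
  have hi (hf : (Set.ofPred p).Finite) : i < hf.toFinset.card :=
    h.trans_le (Nat.count_le_card hf k)
  exact ⟨Nat.nth p i, Nat.nth_lt_of_lt_count h, Nat.nth_mem i hi, Nat.count_nth hi⟩

theorem exists_equiv_of_count_eq {Λ : Type*} [DecidableEq Λ] {w : ℕ → Λ} {n N : ℕ}
    (hw : ∀ l, Nat.count (w · = l) N = n) :
    ∃ e : Fin n × Λ ≃ Fin N, ∀ i l,
      w (e (i, l)) = l ∧ Nat.count (w · = l) (e (i, l)) = i := by
  have count_lt (k : Fin N) : Nat.count (w · = w k) k < n :=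
    (Nat.count_strict_mono (p := (w · = w k)) rfl k.isLt).trans_eq (hw _)
  let f : Fin N → Fin n × Λ := fun k => (⟨_, count_lt k⟩, w k)
  have hf : Function.Bijective f := by
    constructor
    · intro k m h
      obtain ⟨hcount, hletter⟩ := Prod.mk.inj h
      rw [Fin.mk.injEq, hletter] at hcount
      exact Fin.ext (Nat.count_injective (p := (w · = w m)) hletter rfl hcount)
    · rintro ⟨i, l⟩
      obtain ⟨k, hk, rfl, hi⟩ := exists_count_eq_of_lt_count (i.isLt.trans_eq (hw l).symm)
      exact ⟨⟨k, hk⟩, Prod.ext (Fin.ext hi) rfl⟩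
  refine ⟨(Equiv.ofBijective f hf).symm, fun i l => ?_⟩
  obtain ⟨k, hk⟩ := hf.surjective (i, l)
  rw [(Equiv.ofBijective f hf).symm_apply_eq.2 hk.symm]
  obtain ⟨rfl, rfl⟩ := Prod.mk.inj hk
  exact ⟨rfl, rfl⟩

theorem card_filter_le_orderEmbOfFin {α : Type*} [LinearOrder α] {s : Finset α} {n : ℕ}
    (h : s.card = n) (i : Fin n) : (s.filter (· ≤ s.orderEmbOfFin h i)).card = i + 1 := by
  have : s.filter (· ≤ s.orderEmbOfFin h i) =
      (Finset.Iic i).map (s.orderEmbOfFin h).toEmbedding := by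
    ext a
    constructor
    · intro ha
      obtain ⟨has, hai⟩ := Finset.mem_filter.1 ha
      obtain ⟨j, rfl⟩ : a ∈ Set.range (s.orderEmbOfFin h) := by simpa using has
      exact Finset.mem_map_of_mem _ (Finset.mem_Iic.2 ((s.orderEmbOfFin h).le_iff_le.1 hai))
    · intro ha
      obtain ⟨j, hj, rfl⟩ := Finset.mem_map.1 ha
      exact Finset.mem_filter.2 ⟨s.orderEmbOfFin_mem h j,
        (s.orderEmbOfFin h).monotone (Finset.mem_Iic.1 hj)⟩
  rw [this, Finset.card_map, Fin.card_Iic]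

section Words

theorem throughNth_append_cons (l : Letter) (u v : List Letter) :
    throughNth l (u.count l + 1) (u ++ l :: v) = u ++ [l] := by
  induction u with
  | nil => cases v <;> simp [throughNth]
  | cons m u ih =>
    by_cases h : m = l
    · subst h
      simp [throughNth, ih]
    · simp [throughNth, h, ih]

/-- The letter of `W(T)` in position `k`, where positions are counted from `0`. -/
def letterAt (T : Finset ℕ) (k : ℕ) : Letter := nextLetter T (k + 1) (wordPrefix T k)

/-- The number of occurrences of the letter `l` among the first `k` letters of `W(T)`. -/
def letterCount (T : Finset ℕ) (l : Letter) (k : ℕ) : ℕ := Nat.count (letterAt T · = l) k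

variable {T : Finset ℕ}

theorem letterCount_succ (l : Letter) (k : ℕ) :
    letterCount T l (k + 1) = letterCount T l k + if letterAt T k = l then 1 else 0 :=
  Nat.count_succ _ _

theorem letterCount_add (k : ℕ) :
    letterCount T .x k + letterCount T .y k + letterCount T .z k = k := by
  induction k with
  | zero => rfl
  | succ k ih =>
    simp only [letterCount_succ]
    cases letterAt T k <;> simp only [reduceCtorEq, if_true, if_false] <;> omega

theorem count_wordPrefix (l : Letter) (k : ℕ) : (wordPrefix T k).count l = letterCount T l k := by
  induction k with
  | zero => rfl
  | succ k ih =>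
    rw [wordPrefix, List.count_append, ih, letterCount_succ, List.count_singleton]
    exact congrArg _ (if_congr beq_iff_eq rfl rfl)

theorem wordPrefix_eq_append {p k : ℕ} (h : p < k) :
    ∃ v, wordPrefix T k = wordPrefix T p ++ letterAt T p :: v := by
  induction k, h using Nat.le_induction with
  | base => exact ⟨[], rfl⟩
  | succ k _ ih =>
    obtain ⟨v, hv⟩ := ih
    exact ⟨v ++ [letterAt T k], by rw [wordPrefix, ← letterAt, hv, List.append_assoc]; rfl⟩

theorem throughNth_wordPrefix {l : Letter} {p k : ℕ} (h : p < k) (hp : letterAt T p = l) :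
    throughNth l (letterCount T l p + 1) (wordPrefix T k) = wordPrefix T (p + 1) := by
  obtain ⟨v, hv⟩ := wordPrefix_eq_append (T := T) h
  rw [hv, hp, ← count_wordPrefix, throughNth_append_cons, ← hp]
  rfl

theorem zBeforeX_wordPrefix {p k : ℕ} (h : p < k) (hp : letterAt T p = .x) :
    zBeforeX (wordPrefix T k) (letterCount T .x p + 1) = letterCount T .z p := by
  rw [zBeforeX, throughNth_wordPrefix h hp, count_wordPrefix, letterCount_succ, hp]
  rfl

theorem letterAt_eq_z_iff {k : ℕ} : letterAt T k = .z ↔ k + 1 ∈ T := by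
  unfold letterAt nextLetter
  split_ifs <;> simp_all

theorem letterCount_y_ne_x {k : ℕ} (hk : letterAt T k = .y) :
    letterCount T .y k ≠ letterCount T .x k := by
  intro h
  unfold letterAt nextLetter X Y at hk
  rw [count_wordPrefix, count_wordPrefix, if_pos h.symm] at hk
  split_ifs at hk

theorem letterAt_eq_y_iff {k p : ℕ} (hp : p < k) (hpx : letterAt T p = .x)
    (hpk : letterCount T .x p = letterCount T .y k) :
    letterAt T k = .y ↔ k + 1 ∉ T ∧ letterCount T .z p = letterCount T .x k := by
  have hne : letterCount T .x k ≠ letterCount T .y k := by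
    rw [← hpk]
    exact (Nat.count_strict_mono (p := (letterAt T · = .x)) hpx hp).ne'
  rw [letterAt, nextLetter, X, Y, count_wordPrefix, count_wordPrefix, if_neg hne, ← hpk,
    zBeforeX_wordPrefix hp hpx]
  split_ifs <;> simp_all

theorem letterCount_y_le_x (k : ℕ) : letterCount T .y k ≤ letterCount T .x k := by
  induction k with
  | zero => rfl
  | succ k ih =>
    rw [letterCount_succ, letterCount_succ]
    cases hk : letterAt T k with
    | y =>
      have := letterCount_y_ne_x hk
      simp only [reduceCtorEq, if_true, if_false]
      omega
    | _ =>
      simp only [reduceCtorEq, if_true, if_false]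
      omega

/-- Let `p` be the position of the oldest `x` not yet matched by a `y`. While it stays unmatched,
the `x`'s can only accumulate until there are as many of them as `z`'s before `p`; from then on the
rule forces a `y` outside `T`. -/
theorem letterCount_x_le_z {N : ℕ}
    (hT : ∀ k < N, k + 1 ∉ T → k + 1 ≤ 3 * letterCount T .z k) {k : ℕ} (hk : k ≤ N) {p : ℕ}
    (hp : p < k) (hpx : letterAt T p = .x) (hpk : letterCount T .x p = letterCount T .y k) :
    letterCount T .x k ≤ letterCount T .z p := by
  induction k generalizing p with
  | zero => exact absurd hp p.not_lt_zero
  | succ k ih =>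
    have ih := @ih (by omega)
    have hp' : p < k ∨ p = k := Nat.lt_succ_iff_lt_or_eq.1 hp
    rw [letterCount_succ] at hpk ⊢
    cases hl : letterAt T k with
    | z =>
      rw [hl, if_neg (by decide)] at hpk
      rw [if_neg (by decide)]
      exact ih (hp'.resolve_right fun h => by simp [h, hl] at hpx) hpx hpk
    | y =>
      rw [hl, if_pos rfl] at hpk
      rw [if_neg (by decide)]
      have hlt := (letterCount_y_le_x k).lt_of_ne (letterCount_y_ne_x hl)
      obtain ⟨q, hq, hqx, hqk⟩ := exists_count_eq_of_lt_count hlt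
      have hqp : q < p := Nat.lt_of_count_lt_count (p := (letterAt T · = .x))
        (hqk.trans_lt ((Nat.lt_succ_self _).trans_eq hpk.symm))
      rw [← ((letterAt_eq_y_iff hq hqx hqk).1 hl).2]
      exact Nat.count_monotone _ hqp.le
    | x =>
      rw [hl, if_neg (by decide)] at hpk
      rw [if_pos rfl]
      have hkT : k + 1 ∉ T := fun h => by simp [letterAt_eq_z_iff.2 h] at hl
      rcases hp' with hp' | rfl
      · refine (ih hp' hpx hpk).lt_of_ne fun h => ?_
        simp [(letterAt_eq_y_iff hp' hpx hpk).2 ⟨hkT, h.symm⟩] at hl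
      · have hadd := letterCount_add (T := T) p
        have := hT p hk hkT
        omega

theorem letterCount_z_eq_card (hT : 0 ∉ T) (k : ℕ) :
    letterCount T .z k = (T.filter (· ≤ k)).card := by
  have : T.filter (· ≤ k) = ((Finset.range k).filter (letterAt T · = .z)).image (· + 1) := by
    ext m
    simp only [Finset.mem_filter, Finset.mem_image, Finset.mem_range, letterAt_eq_z_iff]
    constructor
    · rintro ⟨hm, hmk⟩
      obtain ⟨m, rfl⟩ := Nat.exists_eq_succ_of_ne_zero (ne_of_mem_of_not_mem hm hT)
      exact ⟨m, ⟨hmk, hm⟩, rfl⟩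
    · rintro ⟨m, ⟨hmk, hm⟩, rfl⟩
      exact ⟨hm, hmk⟩
  rw [this, Finset.card_image_of_injective _ (add_left_injective 1), letterCount,
    Nat.count_eq_card_filter_range]

theorem letterCount_z_of_mem_TSets {n : ℕ} (hT : T ∈ TSets n) : letterCount T .z (3 * n) = n := by
  obtain ⟨hsub, hcard⟩ := Finset.mem_powersetCard.1 (Finset.mem_filter.1 hT).1
  rw [letterCount_z_eq_card fun h0 => by simpa using hsub h0, Finset.filter_true_of_mem, hcard]
  exact fun t ht => (Finset.mem_Icc.1 (hsub ht)).2

theorem le_letterCount_z_of_mem_TSets {n : ℕ} (hT : T ∈ TSets n) {k : ℕ} (hk : k < 3 * n)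
    (hkT : k + 1 ∉ T) : k + 1 ≤ 3 * letterCount T .z k := by
  obtain ⟨hT', hcard, hle⟩ := Finset.mem_filter.1 hT
  have hsub := (Finset.mem_powersetCard.1 hT').1
  by_contra! hlt
  rw [letterCount_z_eq_card fun h0 => by simpa using hsub h0] at hlt
  let i : Fin n := ⟨(T.filter (· ≤ k)).card, by omega⟩
  have hi_le : T.orderEmbOfFin hcard i ≤ k := by
    have hne : T.orderEmbOfFin hcard i ≠ k + 1 :=
      ne_of_mem_of_not_mem (T.orderEmbOfFin_mem hcard i) hkT
    have : T.orderEmbOfFin hcard i + 2 ≤ 3 * ((T.filter (· ≤ k)).card + 1) := hle i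
    omega
  have hcard_le : (T.filter (· ≤ T.orderEmbOfFin hcard i)).card ≤ (T.filter (· ≤ k)).card :=
    Finset.card_le_card (Finset.monotone_filter_right T fun t _ ht => ht.trans hi_le)
  rw [card_filter_le_orderEmbOfFin] at hcard_le
  exact hcard_le.not_gt (Nat.lt_succ_self _)

theorem letterCount_of_mem_TSets {n : ℕ} (hT : T ∈ TSets n) (l : Letter) :
    letterCount T l (3 * n) = n := by
  have hz := letterCount_z_of_mem_TSets hT
  have hadd := letterCount_add (T := T) (3 * n)
  have hx : letterCount T .x (3 * n) = n := by
    rcases (letterCount_y_le_x (T := T) (3 * n)).lt_or_eq with hlt | heq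
    · obtain ⟨p, hp, hpx, hpc⟩ := exists_count_eq_of_lt_count hlt
      have hle := letterCount_x_le_z (fun k => le_letterCount_z_of_mem_TSets hT) le_rfl hp hpx hpc
      have hzp : letterCount T .z p ≤ letterCount T .z (3 * n) := Nat.count_monotone _ hp.le
      omega
    · omega
  cases l <;> omega

end Words

section Readings

variable {T : Finset ℕ} {n m : ℕ}

/-- The row `l` of `e` lists the positions of the letter `l` in `W(T)` in increasing order. -/
def IsReading (T : Finset ℕ) (e : Fin n × Letter ≃ Fin m) : Prop :=
  ∀ i l, letterAt T (e (i, l)) = l ∧ letterCount T l (e (i, l)) = i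

theorem exists_isReading (hT : T ∈ TSets n) :
    ∃ e : Fin n × Letter ≃ Fin (3 * n), IsReading T e :=
  exists_equiv_of_count_eq (letterCount_of_mem_TSets hT)

variable {e : Fin n × Letter ≃ Fin m}

theorem IsReading.lt_iff (he : IsReading T e) {i : Fin n} {l : Letter} {k : ℕ} :
    (e (i, l) : ℕ) < k ↔ (i : ℕ) < letterCount T l k := by
  obtain ⟨hletter, hcount⟩ := he i l
  rw [← hcount]
  exact ⟨Nat.count_strict_mono (p := (letterAt T · = l)) hletter, Nat.lt_of_count_lt_count⟩

theorem IsReading.letterCount_eq (he : IsReading T e) (l : Letter) : letterCount T l m = n := by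
  refine le_antisymm (not_lt.1 fun hlt => ?_) (not_lt.1 fun hlt => ?_)
  · obtain ⟨k, hk, hletter, hcount⟩ := exists_count_eq_of_lt_count hlt
    obtain ⟨⟨i, l'⟩, hi⟩ := e.surjective ⟨k, hk⟩
    obtain ⟨hletter', hcount'⟩ := he i l'
    rw [hi] at hletter' hcount'
    obtain rfl : l' = l := hletter'.symm.trans hletter
    exact i.isLt.ne (hcount'.symm.trans hcount)
  · exact (he.lt_iff.1 (e (⟨_, hlt⟩, l)).isLt).false

theorem IsReading.x_lt_y (he : IsReading T e) (i : Fin n) : e (i, .x) < e (i, .y) := by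
  obtain ⟨hletter, hcount⟩ := he i .y
  rw [Fin.lt_def, he.lt_iff]
  exact hcount.symm.trans_lt ((letterCount_y_le_x _).lt_of_ne (letterCount_y_ne_x hletter))

theorem IsReading.isInterlaced (he : IsReading T e) : IsInterlaced e where
  strictMono l i j hij := by
    rw [Fin.lt_def, he.lt_iff, (he j l).2]
    exact hij
  x_lt_y := he.x_lt_y
  z_lt_x_iff i j := by
    obtain ⟨hx, hxj⟩ := he j .x
    obtain ⟨hy, hyj⟩ := he j .y
    have hzx := ((letterAt_eq_y_iff (he.x_lt_y j) hx (hxj.trans hyj.symm)).1 hy).2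
    rw [Fin.lt_def, Fin.lt_def, he.lt_iff, he.lt_iff, hzx]

theorem IsReading.rowZ_eq (he : IsReading T e) (hT : T ⊆ Finset.Icc 1 m) : rowZ e = T := by
  ext t
  constructor
  · intro ht
    obtain ⟨i, -, rfl⟩ := Finset.mem_image.1 ht
    exact letterAt_eq_z_iff.1 (he i .z).1
  · intro ht
    obtain ⟨ht₁, htm⟩ := Finset.mem_Icc.1 (hT ht)
    obtain ⟨k, rfl⟩ := Nat.exists_eq_add_of_le' ht₁
    obtain ⟨⟨i, l⟩, hi⟩ := e.surjective ⟨k, htm⟩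
    obtain rfl : l = .z := by
      rw [← (he i l).1, hi]
      exact letterAt_eq_z_iff.2 ht
    exact Finset.mem_image.2 ⟨i, Finset.mem_univ i, by rw [hi]⟩

theorem IsReading.mem_blockEnds_iff (he : IsReading T e) (j : Fin n) :
    j ∈ blockEnds e ↔ letterCount T .x (e (j, .y)) = j + 1 := by
  have hj : (j : ℕ) < letterCount T .x (e (j, .y)) := he.lt_iff.1 (he.x_lt_y j)
  have hn : letterCount T .x (e (j, .y)) ≤ n :=
    (Nat.count_monotone _ (e (j, .y)).isLt.le).trans_eq (he.letterCount_eq .x)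
  rw [mem_blockEnds]
  constructor
  · intro hend
    by_contra hne
    let i : Fin n := ⟨j + 1, by omega⟩
    have hi : e (i, .x) < e (j, .y) := he.lt_iff.2 (show (j : ℕ) + 1 < _ by omega)
    exact (hend i (Nat.lt_succ_self j)).asymm hi
  · intro hcount i hji
    refine (not_lt.1 fun hij => ?_).lt_of_ne (by simp)
    have := he.lt_iff.1 hij
    omega

theorem IsReading.X_initialSegment {e : Fin n × Letter ≃ Fin (3 * n)} (he : IsReading T e)
    (j : Fin n) : X (initialSegment (W n T) (j + 1)) = letterCount T .x (e (j, .y)) := by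
  obtain ⟨hletter, hcount⟩ := he j .y
  have hseg := throughNth_wordPrefix (e (j, .y)).isLt hletter
  rw [hcount] at hseg
  rw [initialSegment, W, hseg, X, count_wordPrefix, letterCount_succ, hletter]
  rfl

theorem IsReading.card_blockEnds {e : Fin n × Letter ≃ Fin (3 * n)} (he : IsReading T e) :
    (blockEnds e).card = h n T := by
  rw [h, Y, W, count_wordPrefix, he.letterCount_eq]
  refine Finset.card_bij (fun j _ => (j : ℕ) + 1) (fun j hj => ?_) (fun i _ j _ hij => ?_)
    fun k hk => ?_
  · refine Finset.mem_filter.2 ⟨Finset.mem_Icc.2 ⟨Nat.succ_pos j, j.isLt⟩, ?_⟩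
    rw [← W, he.X_initialSegment, (he.mem_blockEnds_iff j).1 hj]
  · exact Fin.ext (Nat.succ_injective hij)
  · obtain ⟨hkn, hX⟩ := Finset.mem_filter.1 hk
    obtain ⟨hk₁, hkn⟩ := Finset.mem_Icc.1 hkn
    obtain ⟨k, rfl⟩ := Nat.exists_eq_add_of_le' hk₁
    refine ⟨⟨k, hkn⟩, (he.mem_blockEnds_iff _).2 ?_, rfl⟩
    rw [← he.X_initialSegment]
    exact hX

theorem ncard_avStar_minimaSet_eq (hT : T ∈ TSets n) :
    {π ∈ AvStar n pattern321 | minimaSet π = T}.ncard = 2 ^ h n T := by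
  obtain ⟨e, he⟩ := exists_isReading hT
  have hsub := (Finset.mem_powersetCard.1 (Finset.mem_filter.1 hT).1).1
  rw [← he.card_blockEnds, ← he.isInterlaced.ncard_avStar_minimaSet_eq, he.rowZ_eq hsub]

end Readings

end ThreeCycles

theorem mainTheorem5 (n : ℕ) (hn : 1 ≤ n) :
    (ThreeCycles.AvStar n ThreeCycles.pattern321).ncard =
      ∑ T ∈ ThreeCycles.TSets n, 2 ^ ThreeCycles.h n T := by
  classical
  have hfin := Set.toFinite (ThreeCycles.AvStar n ThreeCycles.pattern321)
  have hmaps : ∀ π ∈ hfin.toFinset, ThreeCycles.minimaSet π ∈ ThreeCycles.TSets n := fun π hπ =>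
    ThreeCycles.minimaSet_mem_TSets (hfin.mem_toFinset.1 hπ)
  rw [Set.ncard_eq_toFinset_card _ hfin, Finset.card_eq_sum_card_fiberwise hmaps]
  refine Finset.sum_congr rfl fun T hT => ?_
  rw [← ThreeCycles.ncard_avStar_minimaSet_eq hT, ← Set.ncard_coe_finset, Finset.coe_filter]
  simp only [hfin.mem_toFinset]
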